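/- Let $\mathbb{K}=\mathbb{R}$ or $\mathbb{C}$, let $m\ge 1$ be an integer, $p\in[2,\infty)$, $p^*=\frac{p}{p-1}$, and $1\le s<p^*$. Let $\mathcal{L}(^m\ell_p;\mathbb{K})$ be the Banach space of continuous $m$-linear forms $T:\ell_p\times\cdots\times\ell_p\to\mathbb{K}$ with the sup norm. For a Banach space $E$ over $\mathbb{K}$, let $\ell_s^w(E)$ be the space of sequences $(x_j)_{j\ge1}$ in $E$ such that $(\varphi(x_j))_j\in\ell_s$ for every $\varphi\in E^*$, and put $\|(x_j)_j\|_{w,s}=\sup_{\varphi\in E^*,\,\|\varphi\|\le1}\bigl(\sum_{j}|\varphi(x_j)|^s\bigr)^{1/s}$. For $r>0$, a form $T\in\mathcal{L}(^m\ell_p;\mathbb{K})$ is called multiple $(r;s)$-summing if there is $C>0$ such that $$\Bigl(\sum_{j_1,\dots,j_m=1}^{\infty}\bigl|T(x^{(1)}_{j_1},\dots,x^{(m)}_{j_m})\bigr|^r\Bigr)^{1/r}\le C\prod_{k=1}^m\bigl\|(x^{(k)}_j)_{j}\bigr\|_{w,s}$$ for all $(x^{(1)}_j)_j,\dots,(x^{(m)}_j)_j\in\ell_s^w(\ell_p)$.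 If $$0<r<\frac{2ms}{s+2m-ms},$$ then the set $A$ of all $T\in\mathcal{L}(^m\ell_p;\mathbb{K})$ that are not multiple $(r;s)$-summing is maximal spaceable: $A\cup\{0\}$ contains a closed infinite-dimensional linear subspace $V$ of $\mathcal{L}(^m\ell_p;\mathbb{K})$ with $\dim V=\dim\mathcal{L}(^m\ell_p;\mathbb{K})$. Moreover $\dim\mathcal{L}(^m\ell_p;\mathbb{K})=\mathfrak{c}$, the cardinality of the continuum (dimensions are algebraic, i.e. cardinalities of Hamel bases). -/

import Mathlib

open scoped NNReal ENNReal Cardinal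

noncomputable section

namespace MultipleSumming

/-- `x ∈ ℓ_s^w(E)`: the scalar sequence `(φ (x j))_j` lies in `ℓ_s` for every continuous linear
functional `φ` on `E`. -/
def WeaklySummable (𝕜 : Type*) [RCLike 𝕜] {E : Type*} [NormedAddCommGroup E] [NormedSpace 𝕜 E]
    (s : ℝ) (x : ℕ → E) : Prop :=
  ∀ φ : StrongDual 𝕜 E, Summable fun j => ‖φ (x j)‖ ^ s

/-- The weak `ℓ_s`-norm `‖(x_j)‖_{w,s} = sup_{‖φ‖ ≤ 1} (∑_j |φ(x_j)|^s)^(1/s)`, with values in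
`[0, ∞]`, so that neither the series nor the supremum can take a junk value. -/
def weakNorm (𝕜 : Type*) [RCLike 𝕜] {E : Type*} [NormedAddCommGroup E] [NormedSpace 𝕜 E]
    (s : ℝ) (x : ℕ → E) : ℝ≥0∞ :=
  ⨆ (φ : StrongDual 𝕜 E) (_ : ‖φ‖ ≤ 1), (∑' j, ‖φ (x j)‖ₑ ^ s) ^ (1 / s)

/-- A continuous `m`-linear operator `T : E_1 × ⋯ × E_m → F` is multiple `(r;s)`-summing:
there is `C > 0` such that
`(∑_{j_1,…,j_m} ‖T(x^{(1)}_{j_1},…,x^{(m)}_{j_m})‖^r)^(1/r) ≤ C ∏_k ‖(x^{(k)}_j)_j‖_{w,s}`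
for all sequences `x^{(k)} ∈ ℓ_s^w(E_k)`. -/
def IsMultipleSumming {𝕜 : Type*} [RCLike 𝕜] {m : ℕ} {E : Fin m → Type*}
    [∀ k, NormedAddCommGroup (E k)] [∀ k, NormedSpace 𝕜 (E k)]
    {F : Type*} [NormedAddCommGroup F] [NormedSpace 𝕜 F]
    (r s : ℝ) (T : ContinuousMultilinearMap 𝕜 E F) : Prop :=
  ∃ C : ℝ≥0, 0 < C ∧ ∀ x : (k : Fin m) → ℕ → E k, (∀ k, WeaklySummable 𝕜 s (x k)) →
    (∑' j : Fin m → ℕ, ‖T fun k => x k (j k)‖ₑ ^ r) ^ (1 / r) ≤ C * ∏ k, weakNorm 𝕜 s (x k)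

/-- `A ⊆ E` is maximal spaceable: `A ∪ {0}` contains a closed infinite-dimensional subspace `V`
of `E` with `dim V = dim E` (Hamel dimensions, as cardinals). -/
def IsMaximalSpaceable (𝕜 : Type*) [RCLike 𝕜] {E : Type*} [NormedAddCommGroup E]
    [NormedSpace 𝕜 E] (A : Set E) : Prop :=
  ∃ V : Submodule 𝕜 E, IsClosed (V : Set E) ∧ ¬ FiniteDimensional 𝕜 V ∧
    (V : Set E) ⊆ A ∪ {0} ∧ Module.rank 𝕜 V = Module.rank 𝕜 E

/-- The space `𝓛(^m ℓ_p; 𝕜)` of continuous `m`-linear forms on `ℓ_p × ⋯ × ℓ_p`, with the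
sup norm. -/
abbrev FormsOnLp (𝕜 : Type*) [RCLike 𝕜] (m : ℕ) (p : ℝ≥0∞) [Fact (1 ≤ p)] : Type _ :=
  ContinuousMultilinearMap 𝕜 (fun _ : Fin m => lp (fun _ : ℕ => 𝕜) p) 𝕜

end MultipleSumming

end

/-! On `N` coordinates, random signs give an `m`-linear form with coefficients ±1 and norm O(√N) on
ℓ_2^N (`exists_sign_form`). Pulled back to ℓ_p, it has norm O(N^(1/2 + m(1/2 - 1/p))). The `N` unit
vectors have weak ℓ_s-norm at most N^(1/s + 1/p - 1), while the ℓ_r-sum of the coefficients is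
N^(m/r). After normalising the form, its summing constant is therefore at least of order N^θ with θ
= m/r - 1/2 + m/2 - m/s. Here `p` cancels, and θ > 0 is exactly the hypothesis on `r`.

Put such forms on disjoint blocks of rapidly growing size, with weights making their norms summable,
and sort the blocks into infinitely many classes of infinitely many blocks each. Let `V` be the
forms whose coefficients are, on each class, a multiple of those of this fixed pattern. `V` is
closed because coefficients are continuous in the form. A nonzero member has a nonzero multiple on
some class, and the blocks of that class force its summing constant to be infinite. Bounded
sequences of multiples all occur, in particular the geometric ones with ratio in (0,1). These are
linearly independent, so dim `V` ≥ 𝔠. Conversely a form is determined by countably many scalars, so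
the whole space has dimension at most 𝔠. -/

noncomputable section
namespace MultipleSumming

/-! ### Nets and norms of multilinear maps -/

/-- The closed unit ball of a real normed space of dimension `d` has a `1/2`-net with at most
`5 ^ d` points. -/
lemma exists_half_net (E : Type*) [NormedAddCommGroup E] [NormedSpace ℝ E]
    [FiniteDimensional ℝ E] :
    ∃ N : Finset E, N.card ≤ 5 ^ Module.finrank ℝ E ∧ (∀ y ∈ N, ‖y‖ ≤ 1) ∧
      ∀ x : E, ‖x‖ ≤ 1 → ∃ y ∈ N, ‖x - y‖ ≤ 1 / 2 := by
  classical
  -- Radius 2 and separation 1 are the normalisation of the Besicovitch bound. A separated set of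
  -- maximal size is a 1-net of the ball of radius 2, and is halved at the end.
  let P : Finset E → Prop := fun s =>
    (∀ c ∈ s, ‖c‖ ≤ 2) ∧ ∀ c ∈ s, ∀ d ∈ s, c ≠ d → 1 ≤ ‖c - d‖
  let K : Set ℕ := {k | ∃ s : Finset E, P s ∧ s.card = k}
  have hne : K.Nonempty := ⟨0, ∅, by simp [P], rfl⟩
  have hbdd : BddAbove K :=
    ⟨5 ^ Module.finrank ℝ E, by
      rintro k ⟨s, hs, rfl⟩
      exact Besicovitch.card_le_of_separated s hs.1 hs.2⟩
  obtain ⟨s, hs, hcard⟩ := Nat.sSup_mem hne hbdd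
  have hmax : ∀ x : E, ‖x‖ ≤ 2 → ∃ y ∈ s, ‖x - y‖ < 1 := by
    intro x hx
    by_contra! hcon
    have hxs : x ∉ s := fun h => by
      have := hcon x h
      rw [sub_self, norm_zero] at this
      linarith
    have hP : P (insert x s) := by
      refine ⟨fun c hc => ?_, fun c hc d hd hcd => ?_⟩
      · rcases Finset.mem_insert.1 hc with rfl | hc
        exacts [hx, hs.1 c hc]
      · rcases Finset.mem_insert.1 hc with hc | hc <;> rcases Finset.mem_insert.1 hd with hd | hd
        · exact absurd (hc.trans hd.symm) hcd
        · exact hc ▸ hcon d hd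
        · rw [norm_sub_rev]; exact hd ▸ hcon c hc
        · exact hs.2 c hc d hd hcd
    have := le_csSup hbdd ⟨_, hP, rfl⟩
    rw [Finset.card_insert_of_notMem hxs, ← hcard] at this
    omega
  refine ⟨s.image fun y => (2⁻¹ : ℝ) • y, ?_, ?_, ?_⟩
  · exact Finset.card_image_le.trans (Besicovitch.card_le_of_separated s hs.1 hs.2)
  · intro y hy
    obtain ⟨z, hz, rfl⟩ := Finset.mem_image.1 hy
    rw [norm_smul]
    have := hs.1 z hz
    norm_num
    linarith
  · intro x hx
    obtain ⟨y, hy, hxy⟩ := hmax ((2 : ℝ) • x) (by rw [norm_smul]; norm_num; linarith)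
    refine ⟨_, Finset.mem_image_of_mem _ hy, ?_⟩
    have : x - (2⁻¹ : ℝ) • y = (2⁻¹ : ℝ) • ((2 : ℝ) • x - y) := by
      rw [smul_sub, smul_smul]; norm_num
    rw [this, norm_smul]
    norm_num
    linarith

/-- A continuous linear map bounded by `C` on a `1/2`-net of the unit ball is bounded by `2 C`. -/
lemma norm_le_of_half_net {𝕜 E F : Type*} [RCLike 𝕜] [NormedAddCommGroup E] [NormedSpace 𝕜 E]
    [NormedAddCommGroup F] [NormedSpace 𝕜 F] {N : Set E}
    (hN : ∀ x : E, ‖x‖ ≤ 1 → ∃ y ∈ N, ‖x - y‖ ≤ 1 / 2) (f : E →L[𝕜] F) {C : ℝ} (hC : 0 ≤ C)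
    (hf : ∀ y ∈ N, ‖f y‖ ≤ C) : ‖f‖ ≤ 2 * C := by
  have h : ‖f‖ ≤ C + ‖f‖ * (1 / 2) := by
    refine f.opNorm_le_of_unit_norm (by positivity) fun x hx => ?_
    obtain ⟨y, hy, hxy⟩ := hN x hx.le
    calc ‖f x‖ = ‖f y + f (x - y)‖ := by rw [← map_add]; congr 2; abel
      _ ≤ ‖f y‖ + ‖f (x - y)‖ := norm_add_le _ _
      _ ≤ C + ‖f‖ * (1 / 2) := add_le_add (hf y hy) (f.le_opNorm_of_le hxy)
  linarith

/-- A continuous multilinear map bounded by `C` on the power of a `1/2`-net of the unit ball has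
norm at most `2 ^ m * C`. -/
lemma multilinear_norm_le_of_half_net {𝕜 E F : Type*} [RCLike 𝕜] [NormedAddCommGroup E]
    [NormedSpace 𝕜 E] [NormedAddCommGroup F] [NormedSpace 𝕜 F] {m : ℕ} {N : Set E}
    (hN : ∀ x : E, ‖x‖ ≤ 1 → ∃ y ∈ N, ‖x - y‖ ≤ 1 / 2)
    (T : ContinuousMultilinearMap 𝕜 (fun _ : Fin m => E) F) {C : ℝ} (hC : 0 ≤ C)
    (hT : ∀ y : Fin m → E, (∀ k, y k ∈ N) → ‖T y‖ ≤ C) (x : Fin m → E) :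
    ‖T x‖ ≤ 2 ^ m * C * ∏ k, ‖x k‖ := by
  -- `S` is the set of slots already freed from the net. Freeing one more slot costs a factor 2, by
  -- the linear case with the other slots frozen.
  have key : ∀ S : Finset (Fin m), ∀ x : Fin m → E, (∀ k ∉ S, x k ∈ N) →
      ‖T x‖ ≤ 2 ^ S.card * C * ∏ k ∈ S, ‖x k‖ := by
    intro S
    induction S using Finset.induction_on with
    | empty => intro x hx; simpa using hT x fun k => hx k (by simp)
    | insert a S ha ih =>
      intro x hx
      have hb := norm_le_of_half_net hN (T.toContinuousLinearMap x a)
        (C := 2 ^ S.card * C * ∏ k ∈ S, ‖x k‖) (by positivity) (fun y hy => by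
          have := ih (Function.update x a y) (fun k hk => by
            by_cases hka : k = a
            · subst hka; simpa using hy
            · rw [Function.update_of_ne hka]
              exact hx k (by simp [hka, hk]))
          refine this.trans_eq ?_
          congr 1
          refine Finset.prod_congr rfl fun k hk => ?_
          rw [Function.update_of_ne (by rintro rfl; exact ha hk)])
      have h2 := (T.toContinuousLinearMap x a).le_of_opNorm_le hb (x a)
      simp only [ContinuousMultilinearMap.toContinuousLinearMap_apply,
        Function.update_eq_self] at h2
      rw [Finset.card_insert_of_notMem ha, Finset.prod_insert ha]
      refine h2.trans_eq ?_
      ring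
  simpa using key Finset.univ x (by simp)

/-! ### Random signs and the Kahane–Salem–Zygmund inequality -/

/-- Subgaussian bound for a Rademacher sum, unnormalised: independence factors the sum into terms 2
cosh(a_j), and cosh x ≤ exp(x²/2). -/
lemma sum_signs_exp_le {ι : Type*} [Fintype ι] [DecidableEq ι] (a : ι → ℝ) :
    ∑ ε : ι → ℤˣ, Real.exp (∑ j, ((ε j : ℤ) : ℝ) * a j) ≤
      2 ^ Fintype.card ι * Real.exp ((∑ j, a j ^ 2) / 2) := by
  have h : ∑ ε : ι → ℤˣ, Real.exp (∑ j, ((ε j : ℤ) : ℝ) * a j) =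
      ∏ j, ∑ u : ℤˣ, Real.exp (((u : ℤ) : ℝ) * a j) := by
    rw [Finset.prod_univ_sum, Fintype.piFinset_univ]
    simp_rw [Real.exp_sum]
  rw [h, Finset.sum_div, Real.exp_sum]
  calc _ ≤ ∏ j : ι, 2 * Real.exp (a j ^ 2 / 2) := by
        refine Finset.prod_le_prod (fun _ _ => by positivity) fun j _ => ?_
        have h1 := Real.cosh_le_exp_half_sq (a j)
        rw [Real.cosh_eq] at h1
        have h2 : (Finset.univ : Finset ℤˣ) = {1, -1} := rfl
        rw [h2, Finset.sum_pair (by decide)]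
        simp only [Units.val_one, Int.cast_one, one_mul, Units.val_neg, Int.cast_neg, neg_mul]
        linarith
    _ = _ := by rw [Finset.prod_mul_distrib]; simp

/-- Simultaneous sign choice: finitely many signed sums with `ℓ_2`-normalised coefficients can be
made small by one choice of signs. -/
lemma exists_signs {ι Y : Type*} [Fintype ι] (N : Finset Y) (a : Y → ι → ℝ)
    (ha : ∀ y ∈ N, ∑ j, a y j ^ 2 ≤ 1) {t : ℝ} (ht : 0 ≤ t)
    (hN : 2 * (N.card : ℝ) < Real.exp (t ^ 2 / 2)) :
    ∃ ε : ι → ℤˣ, ∀ y ∈ N, |∑ j, ((ε j : ℤ) : ℝ) * a y j| ≤ t := by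
  classical
  by_contra! hcon
  let S : (ι → ℤˣ) → Y → ℝ := fun ε y => ∑ j, ((ε j : ℤ) : ℝ) * a y j
  have hpos : (0 : ℝ) < 2 ^ Fintype.card ι := by positivity
  have hone : ∀ y ∈ N, ∀ σ : ℝ, σ ^ 2 = 1 →
      ∑ ε : ι → ℤˣ, Real.exp (σ * t * S ε y) ≤ 2 ^ Fintype.card ι * Real.exp (t ^ 2 / 2) := by
    intro y hy σ hσ
    have h1 := sum_signs_exp_le fun j => σ * t * a y j
    have h2 : ∀ ε : ι → ℤˣ, σ * t * S ε y = ∑ j, ((ε j : ℤ) : ℝ) * (σ * t * a y j) := by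
      intro ε
      simp only [S, Finset.mul_sum]
      exact Finset.sum_congr rfl fun j _ => by ring
    simp_rw [h2]
    refine h1.trans ?_
    gcongr
    calc ∑ j, (σ * t * a y j) ^ 2 = t ^ 2 * ∑ j, a y j ^ 2 := by
          rw [Finset.mul_sum]
          exact Finset.sum_congr rfl fun j _ => by rw [mul_pow, mul_pow, hσ, one_mul]
      _ ≤ t ^ 2 * 1 := by gcongr; exact ha y hy
      _ = t ^ 2 := mul_one _
  -- Chernoff's argument with parameter `t`: if every choice of signs fails at some `y`, summing
  -- this over all signs contradicts the moment bound `hone` by a union over `N` and the two tails.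
  have hlow : ∀ ε : ι → ℤˣ, Real.exp (t ^ 2) ≤
      ∑ y ∈ N, (Real.exp (1 * t * S ε y) + Real.exp (-1 * t * S ε y)) := by
    intro ε
    obtain ⟨y, hy, hyt⟩ := hcon ε
    refine le_trans ?_ (Finset.single_le_sum (fun _ _ => by positivity) hy)
    change t < |S ε y| at hyt
    rcases lt_abs.1 hyt with h | h
    · have : Real.exp (t ^ 2) ≤ Real.exp (1 * t * S ε y) := Real.exp_le_exp.2 (by nlinarith)
      exact this.trans (le_add_of_nonneg_right (Real.exp_pos _).le)
    · have : Real.exp (t ^ 2) ≤ Real.exp (-1 * t * S ε y) := Real.exp_le_exp.2 (by nlinarith)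
      exact this.trans (le_add_of_nonneg_left (Real.exp_pos _).le)
  have h1 : (2 : ℝ) ^ Fintype.card ι * Real.exp (t ^ 2) ≤
      N.card * (2 * (2 ^ Fintype.card ι * Real.exp (t ^ 2 / 2))) := by
    calc (2 : ℝ) ^ Fintype.card ι * Real.exp (t ^ 2)
        = ∑ _ε : ι → ℤˣ, Real.exp (t ^ 2) := by simp
      _ ≤ ∑ ε : ι → ℤˣ, ∑ y ∈ N, (Real.exp (1 * t * S ε y) + Real.exp (-1 * t * S ε y)) :=
          Finset.sum_le_sum fun ε _ => hlow ε
      _ = ∑ y ∈ N, ((∑ ε : ι → ℤˣ, Real.exp (1 * t * S ε y)) +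
            ∑ ε : ι → ℤˣ, Real.exp (-1 * t * S ε y)) := by
          rw [Finset.sum_comm]
          simp_rw [Finset.sum_add_distrib]
      _ ≤ ∑ _y ∈ N, 2 * (2 ^ Fintype.card ι * Real.exp (t ^ 2 / 2)) := by
          refine Finset.sum_le_sum fun y hy => ?_
          have := hone y hy 1 (by norm_num)
          have := hone y hy (-1) (by norm_num)
          linarith
      _ = _ := by simp
  have h2 : Real.exp (t ^ 2) = Real.exp (t ^ 2 / 2) * Real.exp (t ^ 2 / 2) := by
    rw [← Real.exp_add]; congr 1; ring
  rw [h2] at h1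
  have hE := Real.exp_pos (t ^ 2 / 2)
  have h3 : (2 : ℝ) ^ Fintype.card ι * Real.exp (t ^ 2 / 2) * Real.exp (t ^ 2 / 2) ≤
      (2 : ℝ) ^ Fintype.card ι * Real.exp (t ^ 2 / 2) * (2 * N.card) := by linarith
  exact absurd (le_of_mul_le_mul_left h3 (by positivity)) (not_le.2 hN)

/-- The `m`-linear form on `𝕜^n` with coefficients `c`. -/
def coeffForm (𝕜 : Type*) [RCLike 𝕜] {m n : ℕ} (c : (Fin m → Fin n) → 𝕜) :
    ContinuousMultilinearMap 𝕜 (fun _ : Fin m => EuclideanSpace 𝕜 (Fin n)) 𝕜 :=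
  ∑ j, c j • (ContinuousMultilinearMap.mkPiAlgebra 𝕜 (Fin m) 𝕜).compContinuousLinearMap
    fun k => EuclideanSpace.proj (𝕜 := 𝕜) (j k)

lemma coeffForm_apply {𝕜 : Type*} [RCLike 𝕜] {m n : ℕ} (c : (Fin m → Fin n) → 𝕜)
    (x : Fin m → EuclideanSpace 𝕜 (Fin n)) :
    coeffForm 𝕜 c x = ∑ j, c j * ∏ k, x k (j k) := by
  simp [coeffForm]

lemma finrank_euclideanSpace_le (𝕜 : Type*) [RCLike 𝕜] (n : ℕ) :
    Module.finrank ℝ (EuclideanSpace 𝕜 (Fin n)) ≤ 2 * n := by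
  have h : Module.finrank ℝ 𝕜 ≤ 2 := by
    have hs : Submodule.span ℝ ({1, RCLike.I} : Set 𝕜) = ⊤ := by
      refine eq_top_iff.2 fun x _ => ?_
      rw [Submodule.mem_span_pair]
      refine ⟨RCLike.re x, RCLike.im x, ?_⟩
      rw [RCLike.real_smul_eq_coe_mul, RCLike.real_smul_eq_coe_mul, mul_one]
      exact RCLike.re_add_im x
    have h1 := finrank_span_le_card (R := ℝ) ({1, RCLike.I} : Set 𝕜)
    rw [hs, finrank_top] at h1
    refine h1.trans ?_
    classical
    rw [Set.toFinset_insert, Set.toFinset_singleton]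
    exact Finset.card_le_two
  rw [(WithLp.linearEquiv 2 ℝ (Fin n → 𝕜)).finrank_eq, Module.finrank_pi_fintype]
  simp only [Finset.sum_const, Finset.card_univ, Fintype.card_fin, smul_eq_mul]
  nlinarith

/-- The Kahane–Salem–Zygmund inequality on Hilbert space: there are `m`-linear forms on `𝕜^n` with
coefficients `±1` and norm `O(√n)`. -/
lemma exists_sign_form (𝕜 : Type*) [RCLike 𝕜] (m : ℕ) :
    ∃ C : ℝ, 0 < C ∧ ∀ n : ℕ, 1 ≤ n → ∃ c : (Fin m → Fin n) → 𝕜, (∀ j, ‖c j‖ = 1) ∧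
      ‖coeffForm 𝕜 c‖ ≤ C * Real.sqrt n := by
  classical
  refine ⟨2 ^ m * (2 * Real.sqrt (2 * (2 + 4 * m))), by positivity, fun n hn => ?_⟩
  obtain ⟨N, hcard, hN1, hN⟩ := exists_half_net (EuclideanSpace 𝕜 (Fin n))
  -- The net has at most 5^(2n) points, so the union bound needs exp(t²/2) > 4·5^(2nm). As 5 ≤ e²,
  -- t²/2 = (2 + 4m)n suffices.
  set t : ℝ := Real.sqrt (2 * (2 + 4 * m)) * Real.sqrt n with ht
  have ht0 : 0 ≤ t := by positivity
  have ht2 : t ^ 2 / 2 = (2 + 4 * m) * n := by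
    rw [ht, mul_pow, Real.sq_sqrt (by positivity), Real.sq_sqrt (by positivity)]; ring
  -- The Boolean selects the real or imaginary part, since `exists_signs` treats real coefficients
  -- only.
  let M := (Fintype.piFinset fun _ : Fin m => N) ×ˢ (Finset.univ : Finset Bool)
  let a : (Fin m → EuclideanSpace 𝕜 (Fin n)) × Bool → (Fin m → Fin n) → ℝ := fun y j =>
    if y.2 then RCLike.re (∏ k, y.1 k (j k)) else RCLike.im (∏ k, y.1 k (j k))
  have hMcard : 2 * (M.card : ℝ) < Real.exp (t ^ 2 / 2) := by
    have h5 : (5 : ℝ) ≤ Real.exp 2 := by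
      have := Real.exp_one_gt_d9
      have h : Real.exp 2 = Real.exp 1 * Real.exp 1 := by rw [← Real.exp_add]; norm_num
      nlinarith
    have hM : (M.card : ℝ) ≤ 5 ^ (2 * n * m) * 2 := by
      have : M.card ≤ 5 ^ (2 * n * m) * 2 := by
        simp only [M, Finset.card_product, Fintype.card_piFinset, Finset.prod_const,
          Finset.card_univ, Fintype.card_fin, Fintype.card_bool]
        refine Nat.mul_le_mul_right _ ?_
        rw [pow_mul]
        refine Nat.pow_le_pow_left (hcard.trans ?_) m
        exact Nat.pow_le_pow_right (by norm_num) (finrank_euclideanSpace_le 𝕜 n)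
      exact_mod_cast this
    have hn' : (1 : ℝ) ≤ n := by exact_mod_cast hn
    calc 2 * (M.card : ℝ) ≤ 4 * 5 ^ (2 * n * m) := by linarith
      _ < Real.exp 2 * Real.exp 2 ^ (2 * n * m) := by
        have : (5 : ℝ) ^ (2 * n * m) ≤ Real.exp 2 ^ (2 * n * m) := by gcongr
        have h0 : (0 : ℝ) < 5 ^ (2 * n * m) := by positivity
        nlinarith
      _ = Real.exp (2 + 2 * (2 * n * m)) := by
        rw [← Real.exp_nat_mul, ← Real.exp_add]; push_cast; congr 1; ring
      _ ≤ Real.exp (t ^ 2 / 2) := by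
        rw [ht2]; refine Real.exp_le_exp.2 ?_; nlinarith
  have ha : ∀ y ∈ M, ∑ j, a y j ^ 2 ≤ 1 := by
    intro y hy
    have hyN : ∀ k, y.1 k ∈ N := by simpa [M] using hy
    calc ∑ j, a y j ^ 2 ≤ ∑ j : Fin m → Fin n, ∏ k, ‖y.1 k (j k)‖ ^ 2 := by
          refine Finset.sum_le_sum fun j _ => ?_
          rw [Finset.prod_pow, ← norm_prod, ← sq_abs]
          gcongr
          simp only [a]
          split_ifs
          exacts [RCLike.abs_re_le_norm _, RCLike.abs_im_le_norm _]
      _ = ∏ k, ∑ i, ‖y.1 k i‖ ^ 2 := by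
          rw [Finset.prod_univ_sum, Fintype.piFinset_univ]
      _ ≤ ∏ _k : Fin m, (1 : ℝ) := by
          refine Finset.prod_le_prod (fun _ _ => by positivity) fun k _ => ?_
          rw [← EuclideanSpace.norm_sq_eq]
          exact pow_le_one₀ (norm_nonneg _) (hN1 _ (hyN k))
      _ = 1 := by simp
  obtain ⟨ε, hε⟩ := exists_signs M a ha ht0 hMcard
  refine ⟨fun j => ((ε j : ℤ) : 𝕜), fun j => ?_, ?_⟩
  · rcases Int.units_eq_one_or (ε j) with h | h <;> simp [h]
  · refine ContinuousMultilinearMap.opNorm_le_bound (by positivity) fun x => ?_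
    have := multilinear_norm_le_of_half_net (N := (N : Set _)) hN
      (coeffForm 𝕜 fun j => ((ε j : ℤ) : 𝕜)) (C := 2 * t) (by positivity) (fun y hy => ?_) x
    · refine this.trans_eq ?_
      rw [ht]; ring
    · rw [coeffForm_apply]
      have hre := hε (y, true) (by simpa [M] using hy)
      have him := hε (y, false) (by simpa [M] using hy)
      refine (?_ : _ ≤ |RCLike.re (∑ j, ((ε j : ℤ) : 𝕜) * ∏ k, y k (j k))| +
        |RCLike.im (∑ j, ((ε j : ℤ) : 𝕜) * ∏ k, y k (j k))|).trans ?_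
      · nth_rw 1 [← RCLike.re_add_im (∑ j, ((ε j : ℤ) : 𝕜) * ∏ k, y k (j k))]
        refine (norm_add_le _ _).trans (add_le_add (RCLike.norm_ofReal _).le ?_)
        rw [norm_mul, RCLike.norm_ofReal]
        exact mul_le_of_le_one_right (abs_nonneg _) (by
          rw [RCLike.norm_I]; split_ifs <;> norm_num)
      have hc : ∀ j, (((ε j : ℤ) : 𝕜)) = ((((ε j : ℤ) : ℝ)) : 𝕜) := fun j => by push_cast; rfl
      rw [map_sum, map_sum]
      simp only [hc, RCLike.re_ofReal_mul, RCLike.im_ofReal_mul]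
      simp only [a, if_true, Bool.false_eq_true, if_false] at hre him
      linarith


/-! ### Finitely many coordinates of ℓ_p -/

lemma sum_rpow_le_card_rpow_mul {ι : Type*} (B : Finset ι) (hB : B.Nonempty) {w : ι → ℝ}
    (hw : ∀ i ∈ B, 0 ≤ w i) {θ : ℝ} (h0 : 0 ≤ θ) (h1 : θ ≤ 1) :
    ∑ i ∈ B, w i ^ θ ≤ (B.card : ℝ) ^ (1 - θ) * (∑ i ∈ B, w i) ^ θ := by
  have hN : (0 : ℝ) < B.card := by exact_mod_cast hB.card_pos
  have h := (Real.concaveOn_rpow h0 h1).le_map_sum (t := B) (w := fun _ => (B.card : ℝ)⁻¹) (p := w)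
    (fun _ _ => by positivity) (by simp [hN.ne']) (fun i hi => hw i hi)
  simp only [smul_eq_mul, ← Finset.mul_sum] at h
  rw [Real.mul_rpow (by positivity) (Finset.sum_nonneg hw), inv_mul_le_iff₀ hN,
    Real.inv_rpow hN.le, ← mul_assoc] at h
  rwa [Real.rpow_sub hN, Real.rpow_one, div_eq_mul_inv]

/-- The unit vector `e_i` of `ℓ_p`. -/
abbrev unitVec (𝕜 : Type*) [RCLike 𝕜] (p : ℝ≥0∞) (i : ℕ) : lp (fun _ : ℕ => 𝕜) p :=
  lp.single p i (1 : 𝕜)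

section LpFact
variable {𝕜 : Type*} [RCLike 𝕜] {p : ℝ≥0∞} [Fact (1 ≤ p)]

/-- Duality: evaluate φ at the vector with entries of modulus |φ(e_i)|^(s-1) and phases conjugate to
those of φ(e_i), which gives S = ∑ |φ(e_i)|^s. Since (s-1)p ≤ s, Jensen bounds the norm of this
vector by powers of `B.card` and of S, and S is then solved for. -/
lemma sum_functional_rpow_le (hp : p ≠ ∞) {s : ℝ} (hs1 : 1 ≤ s)
    (hsp : (s - 1) * p.toReal ≤ s) (B : Finset ℕ) (hB : B.Nonempty)
    (φ : StrongDual 𝕜 (lp (fun _ : ℕ => 𝕜) p)) (hφ : ‖φ‖ ≤ 1) :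
    (∑ i ∈ B, ‖φ (unitVec 𝕜 p i)‖ ^ s) ^ (1 / s) ≤ (B.card : ℝ) ^ (1 / s + 1 / p.toReal - 1) := by
  have hP1 : 1 ≤ p.toReal := by
    rw [← ENNReal.toReal_one]; exact ENNReal.toReal_mono hp Fact.out
  set P := p.toReal
  have hP : 0 < P := by linarith
  have hs : 0 < s := by linarith
  have hN : (0 : ℝ) < B.card := by exact_mod_cast hB.card_pos
  set v : ℕ → ℝ := fun i => ‖φ (unitVec 𝕜 p i)‖ with hv
  have hv0 : ∀ i, 0 ≤ v i := fun i => norm_nonneg _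
  set S := ∑ i ∈ B, v i ^ s with hS
  have hS0 : 0 ≤ S := Finset.sum_nonneg fun i _ => Real.rpow_nonneg (hv0 i) s
  rcases hS0.eq_or_lt with h0 | hSpos
  · rw [← h0, Real.zero_rpow (by positivity)]; positivity
  -- Where `v i = 0` the conjugate factor vanishes, so the default value of the inverse is harmless.
  -- For `s = 1` the bound `hu` is then strict.
  let u : ℕ → 𝕜 := fun i =>
    ((v i ^ (s - 1) * (v i)⁻¹ : ℝ) : 𝕜) * (starRingEnd 𝕜) (φ (unitVec 𝕜 p i))
  have hu : ∀ i, ‖u i‖ ≤ v i ^ (s - 1) := by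
    intro i
    rw [norm_mul, RCLike.norm_conj, RCLike.norm_ofReal, abs_of_nonneg (by positivity), mul_assoc]
    exact mul_le_of_le_one_right (by positivity) (inv_mul_le_one)
  set x : lp (fun _ : ℕ => 𝕜) p := ∑ i ∈ B, lp.single p i (u i) with hx
  have hφx : φ x = ((S : ℝ) : 𝕜) := by
    rw [hx, map_sum, hS, RCLike.ofReal_sum]
    refine Finset.sum_congr rfl fun i _ => ?_
    have : lp.single p i (u i) = u i • unitVec 𝕜 p i := by
      rw [← lp.single_smul]; simp
    rw [this, map_smul, smul_eq_mul, mul_assoc, RCLike.conj_mul, ← RCLike.ofReal_pow,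
      ← RCLike.ofReal_mul]
    congr 1
    change v i ^ (s - 1) * (v i)⁻¹ * v i ^ 2 = v i ^ s
    rcases (hv0 i).eq_or_lt with h | h
    · rw [← h, Real.zero_rpow hs.ne']; simp
    · rw [Real.rpow_sub h, Real.rpow_one]; field_simp
  have hxn : ‖x‖ ^ P ≤ ∑ i ∈ B, v i ^ ((s - 1) * P) := by
    rw [hx, lp.norm_sum_single hP]
    refine Finset.sum_le_sum fun i _ => ?_
    rw [Real.rpow_mul (hv0 i)]
    exact Real.rpow_le_rpow (norm_nonneg _) (hu i) hP.le
  have hθ : ∑ i ∈ B, v i ^ ((s - 1) * P) ≤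
      (B.card : ℝ) ^ (1 - (s - 1) * P / s) * S ^ ((s - 1) * P / s) := by
    refine le_trans (le_of_eq ?_) (sum_rpow_le_card_rpow_mul B hB (w := fun i => v i ^ s)
      (fun i _ => Real.rpow_nonneg (hv0 i) s) (θ := (s - 1) * P / s)
      (div_nonneg (mul_nonneg (by linarith) hP.le) hs.le) ((div_le_one hs).2 hsp))
    refine Finset.sum_congr rfl fun i _ => ?_
    rw [← Real.rpow_mul (hv0 i)]
    congr 1
    field_simp
  have hSx : S ≤ ‖x‖ := by
    have := φ.le_of_opNorm_le hφ x
    rwa [hφx, RCLike.norm_ofReal, abs_of_pos hSpos, one_mul] at this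
  have h2 : S ^ P ≤ (B.card : ℝ) ^ (1 - (s - 1) * P / s) * S ^ ((s - 1) * P / s) :=
    (Real.rpow_le_rpow hS0 hSx hP.le).trans (hxn.trans hθ)
  have h3 : S ^ (P / s) ≤ (B.card : ℝ) ^ (1 - (s - 1) * P / s) := by
    have : S ^ P = S ^ (P / s) * S ^ ((s - 1) * P / s) := by
      rw [← Real.rpow_add hSpos]; congr 1; field_simp; ring
    rw [this] at h2
    exact le_of_mul_le_mul_right h2 (by positivity)
  have h4 := Real.rpow_le_rpow (by positivity) h3 (one_div_nonneg.2 hP.le)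
  rw [← Real.rpow_mul hS0, ← Real.rpow_mul hN.le] at h4
  convert h4 using 2 <;> field_simp
  ring

/-- The sequence of those unit vectors whose index lies in `B`. -/
def blockSeq (𝕜 : Type*) [RCLike 𝕜] (p : ℝ≥0∞) (B : Finset ℕ) (j : ℕ) :
    lp (fun _ : ℕ => 𝕜) p :=
  if j ∈ B then unitVec 𝕜 p j else 0

lemma weaklySummable_blockSeq {s : ℝ} (hs : 0 < s) (B : Finset ℕ) :
    WeaklySummable 𝕜 s (blockSeq 𝕜 p B) := fun φ =>
  summable_of_ne_finset_zero (s := B) fun j hj => by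
    simp [blockSeq, hj, Real.zero_rpow hs.ne']

lemma weakNorm_blockSeq_le (hp : p ≠ ∞) {s : ℝ} (hs1 : 1 ≤ s)
    (hsp : (s - 1) * p.toReal ≤ s) (B : Finset ℕ) (hB : B.Nonempty) :
    weakNorm 𝕜 s (blockSeq 𝕜 p B) ≤
      ENNReal.ofReal ((B.card : ℝ) ^ (1 / s + 1 / p.toReal - 1)) := by
  have hs : 0 < s := by linarith
  refine iSup₂_le fun φ hφ => ?_
  rw [tsum_eq_sum (s := B) fun j hj => by simp [blockSeq, hj, hs]]
  have h : ∑ j ∈ B, ‖φ (blockSeq 𝕜 p B j)‖ₑ ^ s =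
      ENNReal.ofReal (∑ j ∈ B, ‖φ (unitVec 𝕜 p j)‖ ^ s) := by
    rw [ENNReal.ofReal_sum_of_nonneg fun _ _ => by positivity]
    refine Finset.sum_congr rfl fun j hj => ?_
    rw [blockSeq, if_pos hj, ← ofReal_norm,
      ENNReal.ofReal_rpow_of_nonneg (norm_nonneg _) hs.le]
  rw [h, ENNReal.ofReal_rpow_of_nonneg (Finset.sum_nonneg fun _ _ => by positivity)
    (by positivity)]
  exact ENNReal.ofReal_le_ofReal (sum_functional_rpow_le hp hs1 hsp B hB φ hφ)

/-- Norm of the identity from ℓ_p^n to ℓ_2^n, by Jensen with exponent 2/p ≤ 1. -/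
lemma norm_comp_le_of_injective (hp2 : 2 ≤ p) (hp : p ≠ ∞) {n : ℕ} (hn : 1 ≤ n) {b : Fin n → ℕ}
    (hb : Function.Injective b) (x : lp (fun _ : ℕ => 𝕜) p) :
    ‖WithLp.toLp 2 fun i => x (b i)‖ ≤ (n : ℝ) ^ (1 / 2 - 1 / p.toReal) * ‖x‖ := by
  have hP2 : 2 ≤ p.toReal := by
    have := ENNReal.toReal_mono hp hp2
    simpa using this
  set P := p.toReal
  have hP : 0 < P := by linarith
  have hn0 : (0 : ℝ) < n := by exact_mod_cast hn
  have : Nonempty (Fin n) := ⟨⟨0, hn⟩⟩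
  have h1 := sum_rpow_le_card_rpow_mul (Finset.univ : Finset (Fin n)) Finset.univ_nonempty
    (w := fun i => ‖x (b i)‖ ^ P) (fun i _ => by positivity) (θ := 2 / P) (by positivity)
    ((div_le_one hP).2 hP2)
  have h2 : ∑ i, ‖x (b i)‖ ^ P ≤ ‖x‖ ^ P := by
    have := lp.sum_rpow_le_norm_rpow hP x (Finset.univ.map ⟨b, hb⟩)
    simpa using this
  refine le_of_sq_le_sq ?_ (by positivity)
  rw [EuclideanSpace.norm_sq_eq]
  calc ∑ i, ‖x (b i)‖ ^ 2 = ∑ i, (‖x (b i)‖ ^ P) ^ (2 / P) := by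
        refine Finset.sum_congr rfl fun i _ => ?_
        rw [← Real.rpow_mul (norm_nonneg _), mul_div_cancel₀ _ hP.ne']; simp
    _ ≤ (n : ℝ) ^ (1 - 2 / P) * (‖x‖ ^ P) ^ (2 / P) := by
        refine h1.trans ?_
        simp only [Finset.card_univ, Fintype.card_fin]
        gcongr
    _ = _ := by
        rw [← Real.rpow_mul (norm_nonneg _), mul_div_cancel₀ _ hP.ne', mul_pow,
          ← Real.rpow_natCast ((n : ℝ) ^ _), ← Real.rpow_mul hn0.le]
        norm_num
        left
        congr 1
        field_simp

/-- Restriction of an element of `ℓ_p` to the coordinates `b 0, …, b (n - 1)`. -/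
def restrictCoords (hp2 : 2 ≤ p) (hp : p ≠ ∞) {n : ℕ} (hn : 1 ≤ n) {b : Fin n → ℕ}
    (hb : Function.Injective b) : lp (fun _ : ℕ => 𝕜) p →L[𝕜] EuclideanSpace 𝕜 (Fin n) :=
  LinearMap.mkContinuous
    { toFun := fun x => WithLp.toLp 2 fun i => x (b i)
      map_add' := fun x y => by ext i; simp
      map_smul' := fun c x => by ext i; simp }
    ((n : ℝ) ^ (1 / 2 - 1 / p.toReal)) (norm_comp_le_of_injective hp2 hp hn hb)

@[simp] lemma restrictCoords_apply (hp2 : 2 ≤ p) (hp : p ≠ ∞) {n : ℕ} (hn : 1 ≤ n) {b : Fin n → ℕ}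
    (hb : Function.Injective b) (x : lp (fun _ : ℕ => 𝕜) p) (i : Fin n) :
    restrictCoords hp2 hp hn hb x i = x (b i) := rfl

lemma norm_restrictCoords_le (hp2 : 2 ≤ p) (hp : p ≠ ∞) {n : ℕ} (hn : 1 ≤ n) {b : Fin n → ℕ}
    (hb : Function.Injective b) :
    ‖restrictCoords (𝕜 := 𝕜) hp2 hp hn hb‖ ≤ (n : ℝ) ^ (1 / 2 - 1 / p.toReal) :=
  LinearMap.mkContinuous_norm_le _ (by positivity) _

/-- A continuous multilinear form on `ℓ_p`, `p < ∞`, is determined by its coefficients. -/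
lemma form_ext (hp : p ≠ ∞) {m : ℕ} {T T' : FormsOnLp 𝕜 m p}
    (h : ∀ j : Fin m → ℕ, (T fun k => unitVec 𝕜 p (j k)) = T' fun k => unitVec 𝕜 p (j k)) :
    T = T' := by
  have key : ∀ S : Finset (Fin m), ∀ x : Fin m → lp (fun _ : ℕ => 𝕜) p,
      (∀ k ∉ S, ∃ i, x k = unitVec 𝕜 p i) → T x = T' x := by
    intro S
    induction S using Finset.induction_on with
    | empty =>
      intro x hx
      choose i hi using fun k => hx k (by simp)
      rw [show x = fun k => unitVec 𝕜 p (i k) from funext hi]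
      exact h i
    | insert a S ha ih =>
      intro x hx
      have : T.toContinuousLinearMap x a = T'.toContinuousLinearMap x a := by
        refine lp.ext_continuousLinearMap hp fun i => ?_
        ext
        simp only [ContinuousLinearMap.comp_apply, lp.singleContinuousLinearMap_apply,
          ContinuousMultilinearMap.toContinuousLinearMap_apply]
        refine ih _ fun k hk => ?_
        by_cases hka : k = a
        · subst hka; exact ⟨i, by simp⟩
        · rw [Function.update_of_ne hka]
          exact hx k (by simp [hka, hk])
      simpa using DFunLike.congr_fun this (x a)
  ext x
  exact key Finset.univ x (by simp)

end LpFact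

/-! ### Dimension, and subspaces defined by coefficients -/

lemma mk_rclike_le (𝕜 : Type*) [RCLike 𝕜] : #𝕜 ≤ 𝔠 := by
  have h := Cardinal.mk_le_of_injective (α := ULift.{0} 𝕜) (β := ULift (ℝ × ℝ))
    (f := fun z => ⟨(RCLike.re z.down, RCLike.im z.down)⟩) (fun z w h => by
      simp only [ULift.up.injEq, Prod.mk.injEq] at h
      exact ULift.down_injective (RCLike.ext h.1 h.2))
  simpa [Cardinal.mk_uLift, Cardinal.mk_prod, Cardinal.mk_real] using h

section LpFact
variable {𝕜 : Type*} [RCLike 𝕜] {p : ℝ≥0∞} [Fact (1 ≤ p)]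

lemma rank_forms_le (hp : p ≠ ∞) (m : ℕ) : Module.rank 𝕜 (FormsOnLp 𝕜 m p) ≤ 𝔠 := by
  refine (rank_le_card 𝕜 _).trans ?_
  have hinj : Function.Injective fun (T : FormsOnLp 𝕜 m p) (j : Fin m → ℕ) =>
      T fun k => unitVec 𝕜 p (j k) := fun T T' h => form_ext hp fun j => congrFun h j
  refine (Cardinal.mk_le_of_injective hinj).trans ?_
  have h1 : #((Fin m → ℕ) → 𝕜) = #𝕜 ^ Cardinal.lift #(Fin m → ℕ) := by
    simp
  calc #((Fin m → ℕ) → 𝕜) = #𝕜 ^ Cardinal.lift #(Fin m → ℕ) := h1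
    _ ≤ 𝔠 ^ Cardinal.lift #(Fin m → ℕ) := Cardinal.power_le_power_right (mk_rclike_le 𝕜)
    _ ≤ 𝔠 ^ ℵ₀ := Cardinal.power_le_power_left Cardinal.continuum_ne_zero
        (Cardinal.lift_le_aleph0.2 Cardinal.mk_le_aleph0)
    _ = 𝔠 := Cardinal.continuum_power_aleph0

/-- Dedekind's independence of characters, applied to k ↦ t^k; `Multiplicative` turns these into
monoid homomorphisms. -/
lemma linearIndependent_geometric (𝕜 : Type*) [RCLike 𝕜] :
    LinearIndependent 𝕜 fun (t : Set.Ioo (0 : ℝ) 1) (k : Multiplicative ℕ) =>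
      (((t : ℝ) : 𝕜)) ^ k.toAdd := by
  have h := (linearIndependent_monoidHom (Multiplicative ℕ) 𝕜).comp
    (fun t : Set.Ioo (0 : ℝ) 1 => powersHom 𝕜 ((t : ℝ) : 𝕜))
    (fun t t' h => Subtype.ext (RCLike.ofReal_injective ((powersHom 𝕜).injective h)))
  exact h

/-- The forms on `ℓ_p` whose coefficients are, on every level set of `κ`, a multiple of the
coefficients `t`; here `J k` is a reference index in the level set `κ = k`. -/
def proportionalForms (𝕜 : Type*) [RCLike 𝕜] (p : ℝ≥0∞) [Fact (1 ≤ p)] {m : ℕ}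
    (t : (Fin m → ℕ) → 𝕜) (κ : (Fin m → ℕ) → ℕ) (J : ℕ → Fin m → ℕ) :
    Submodule 𝕜 (FormsOnLp 𝕜 m p) where
  -- Proportionality is cross-multiplied, so each condition is visibly linear and closed in `T`.
  carrier := {T | ∀ j, t (J (κ j)) * T (fun k => unitVec 𝕜 p (j k)) =
    T (fun k => unitVec 𝕜 p (J (κ j) k)) * t j}
  add_mem' {T T'} h h' j := by
    simp only [add_apply, mul_add, add_mul]
    rw [h j, h' j]
  zero_mem' j := by simp
  smul_mem' c T h j := by
    simp only [smul_apply, smul_eq_mul]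
    rw [mul_left_comm, h j, mul_assoc]

lemma isClosed_proportionalForms {m : ℕ} (t : (Fin m → ℕ) → 𝕜) (κ : (Fin m → ℕ) → ℕ)
    (J : ℕ → Fin m → ℕ) : IsClosed (proportionalForms 𝕜 p t κ J : Set (FormsOnLp 𝕜 m p)) := by
  have h : (proportionalForms 𝕜 p t κ J : Set (FormsOnLp 𝕜 m p)) =
      ⋂ j, {T | t (J (κ j)) * T (fun k => unitVec 𝕜 p (j k)) =
        T (fun k => unitVec 𝕜 p (J (κ j) k)) * t j} := by
    ext T; simp [proportionalForms]
  rw [h]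
  refine isClosed_iInter fun j => isClosed_eq ?_ ?_
  · exact continuous_const.mul (ContinuousMultilinearMap.apply 𝕜 _ 𝕜 _).continuous
  · exact (ContinuousMultilinearMap.apply 𝕜 _ 𝕜 _).continuous.mul continuous_const

/-- A criterion for maximal spaceability in `𝓛(^m ℓ_p)` in terms of coefficients. -/
lemma isMaximalSpaceable_of_coefficients (hp : p ≠ ∞) {m : ℕ} (A : Set (FormsOnLp 𝕜 m p))
    (t : (Fin m → ℕ) → 𝕜) (κ : (Fin m → ℕ) → ℕ) (J : ℕ → Fin m → ℕ) (hκ : ∀ k, κ (J k) = k)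
    (ht : ∀ k, t (J k) ≠ 0)
    (hfam : ∀ c : ℕ → 𝕜, (∀ k, ‖c k‖ ≤ 1) →
      ∃ T : FormsOnLp 𝕜 m p, ∀ j, T (fun k => unitVec 𝕜 p (j k)) = c (κ j) * t j)
    (hA : ∀ (T : FormsOnLp 𝕜 m p) (k : ℕ) (c : 𝕜), c ≠ 0 →
      (∀ j, κ j = k → T (fun k => unitVec 𝕜 p (j k)) = c * t j) → T ∈ A) :
    IsMaximalSpaceable 𝕜 A ∧ Module.rank 𝕜 (FormsOnLp 𝕜 m p) = 𝔠 := by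
  set V := proportionalForms 𝕜 p t κ J with hV
  have hlow : 𝔠 ≤ Module.rank 𝕜 V := by
    have hex : ∀ u : Set.Ioo (0 : ℝ) 1, ∃ T : FormsOnLp 𝕜 m p,
        ∀ j, T (fun k => unitVec 𝕜 p (j k)) = ((u : ℝ) : 𝕜) ^ κ j * t j := fun u =>
      hfam (fun k => ((u : ℝ) : 𝕜) ^ k) fun k => by
        rw [norm_pow, RCLike.norm_ofReal, abs_of_pos u.2.1]
        exact pow_le_one₀ u.2.1.le u.2.2.le
    choose T hT using hex
    let v : Set.Ioo (0 : ℝ) 1 → V := fun u => ⟨T u, fun j => by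
      rw [hT, hT, hκ]; ring⟩
    -- `Φ` reads off the multiple on each level set, so it sends `v u` to the geometric sequence of
    -- ratio `u`.
    let Φ : V →ₗ[𝕜] (Multiplicative ℕ → 𝕜) :=
      { toFun := fun S k => (S : FormsOnLp 𝕜 m p) (fun i => unitVec 𝕜 p (J k.toAdd i)) *
          (t (J k.toAdd))⁻¹
        map_add' := fun S S' => by ext k; simp [add_mul]
        map_smul' := fun c S => by ext k; simp [mul_assoc] }
    have hli : LinearIndependent 𝕜 v := by
      refine LinearIndependent.of_comp Φ ?_
      convert linearIndependent_geometric 𝕜 using 1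
      ext u k
      simp only [Function.comp_apply, Φ, v, LinearMap.coe_mk, AddHom.coe_mk]
      rw [hT, hκ, mul_inv_cancel_right₀ (ht _)]
    have := hli.cardinal_lift_le_rank
    rw [Cardinal.mk_Ioo_real zero_lt_one] at this
    simpa using this
  have hup := rank_forms_le (𝕜 := 𝕜) hp m
  have hVle : Module.rank 𝕜 V ≤ Module.rank 𝕜 (FormsOnLp 𝕜 m p) := Submodule.rank_le V
  refine ⟨⟨V, isClosed_proportionalForms t κ J, fun hfin => ?_, fun T hT => ?_,
    hVle.antisymm (hup.trans hlow)⟩, hup.antisymm (hlow.trans hVle)⟩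
  · exact absurd (hlow.trans_lt (Module.rank_lt_aleph0 𝕜 V))
      (not_lt.2 Cardinal.aleph0_le_continuum)
  · by_cases h0 : T = 0
    · exact Or.inr h0
    left
    have hTj : ∀ j, T (fun k => unitVec 𝕜 p (j k)) =
        T (fun k => unitVec 𝕜 p (J (κ j) k)) * (t (J (κ j)))⁻¹ * t j := by
      intro j
      have := hT j
      field_simp [ht (κ j)]
      linear_combination this
    obtain ⟨k, hk⟩ : ∃ k, T (fun i => unitVec 𝕜 p (J k i)) ≠ 0 := by
      by_contra! hcon
      exact h0 (form_ext hp fun j => by rw [hTj, hcon]; simp)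
    refine hA T k _ (mul_ne_zero hk (inv_ne_zero (ht k))) fun j hj => ?_
    rw [hTj, hj]

/-! ### Block forms and their summing constants -/

/-- Testing a multiple summing form with constant modulus coefficients on a block against the
unit vectors of the block. -/
lemma summing_block_estimate (hp : p ≠ ∞) {m : ℕ} {r s : ℝ} (hr : 0 < r) (hs1 : 1 ≤ s)
    (hsp : (s - 1) * p.toReal ≤ s) {T : FormsOnLp 𝕜 m p} {C : ℝ≥0}
    (hT : ∀ x : Fin m → ℕ → lp (fun _ : ℕ => 𝕜) p, (∀ k, WeaklySummable 𝕜 s (x k)) →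
      (∑' j : Fin m → ℕ, ‖T fun k => x k (j k)‖ₑ ^ r) ^ (1 / r) ≤ C * ∏ k, weakNorm 𝕜 s (x k))
    {n : ℕ} (hn : 1 ≤ n) {b : Fin n → ℕ} (hb : Function.Injective b) {a : ℝ} (ha : 0 ≤ a)
    (hTa : ∀ i : Fin m → Fin n, ‖T fun k => unitVec 𝕜 p (b (i k))‖ = a) :
    (n : ℝ) ^ (m / r) * a ≤ C * ((n : ℝ) ^ (1 / s + 1 / p.toReal - 1)) ^ m := by
  have hs : 0 < s := by linarith
  set B : Finset ℕ := Finset.univ.map ⟨b, hb⟩ with hB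
  have hBcard : B.card = n := by simp [hB]
  have hBne : B.Nonempty := Finset.card_pos.1 (by omega)
  have h := hT (fun _ => blockSeq 𝕜 p B) fun _ => weaklySummable_blockSeq hs B
  have hup : ∏ _k : Fin m, weakNorm 𝕜 s (blockSeq 𝕜 p B) ≤
      ENNReal.ofReal (((n : ℝ) ^ (1 / s + 1 / p.toReal - 1)) ^ m) := by
    rw [Finset.prod_const, Finset.card_univ, Fintype.card_fin, ENNReal.ofReal_pow (by positivity)]
    gcongr
    exact hBcard ▸ weakNorm_blockSeq_le hp hs1 hsp B hBne
  have hlow : ENNReal.ofReal ((n : ℝ) ^ m * a ^ r) ≤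
      ∑' j : Fin m → ℕ, ‖T fun k => blockSeq 𝕜 p B (j k)‖ₑ ^ r := by
    have hinj : Function.Injective fun (i : Fin m → Fin n) (k : Fin m) => b (i k) :=
      fun i i' h => funext fun k => hb (congrFun h k)
    refine le_trans ?_ (ENNReal.tsum_comp_le_tsum_of_injective hinj _)
    have hterm : ∀ i : Fin m → Fin n,
        ‖T fun k => blockSeq 𝕜 p B (b (i k))‖ₑ ^ r = ENNReal.ofReal (a ^ r) := by
      intro i
      have : (fun k => blockSeq 𝕜 p B (b (i k))) = fun k => unitVec 𝕜 p (b (i k)) := by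
        ext1 k; rw [blockSeq, if_pos (by simp [hB])]
      rw [this, ← ofReal_norm, hTa, ENNReal.ofReal_rpow_of_nonneg ha hr.le]
    simp only [hterm, tsum_fintype, Finset.sum_const, Finset.card_univ, Fintype.card_pi,
      Fintype.card_fin, Finset.prod_const, nsmul_eq_mul]
    rw [ENNReal.ofReal_mul (by positivity)]
    simp
  have hfin := (ENNReal.rpow_le_rpow hlow (one_div_nonneg.2 hr.le)).trans
    (h.trans (mul_le_mul_right hup _))
  rw [ENNReal.ofReal_rpow_of_nonneg (by positivity) (by positivity), ← ENNReal.ofReal_coe_nnreal,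
    ← ENNReal.ofReal_mul (by positivity), ENNReal.ofReal_le_ofReal_iff (by positivity),
    Real.mul_rpow (by positivity) (by positivity), ← Real.rpow_natCast,
    ← Real.rpow_mul (by positivity), ← Real.rpow_mul ha, mul_one_div, mul_one_div,
    div_self hr.ne', Real.rpow_one] at hfin
  exact hfin

lemma pair_val_injective (n N : ℕ) : Function.Injective fun i : Fin N => Nat.pair n i :=
  fun _ _ h => Fin.ext (Nat.pair_eq_pair.1 h).2

/-- The form with coefficients `c` on the coordinates `pair n 0, pair n 1, …`. -/
def blockForm (hp2 : 2 ≤ p) (hp : p ≠ ∞) {m N : ℕ} (hN : 1 ≤ N) (n : ℕ)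
    (c : (Fin m → Fin N) → 𝕜) : FormsOnLp 𝕜 m p :=
  (coeffForm 𝕜 c).compContinuousLinearMap fun _ => restrictCoords hp2 hp hN
    (pair_val_injective n N)

lemma norm_blockForm_le (hp2 : 2 ≤ p) (hp : p ≠ ∞) {m N : ℕ} (hN : 1 ≤ N) (n : ℕ)
    (c : (Fin m → Fin N) → 𝕜) :
    ‖blockForm (p := p) hp2 hp hN n c‖ ≤
      ‖coeffForm 𝕜 c‖ * ((N : ℝ) ^ (1 / 2 - 1 / p.toReal)) ^ m := by
  refine (ContinuousMultilinearMap.norm_compContinuousLinearMap_le _ _).trans ?_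
  gcongr
  rw [Finset.prod_const, Finset.card_univ, Fintype.card_fin]
  gcongr
  exact norm_restrictCoords_le _ _ _ _

lemma blockForm_unitVec (hp2 : 2 ≤ p) (hp : p ≠ ∞) {m N : ℕ} (hN : 1 ≤ N) (n : ℕ)
    (c : (Fin m → Fin N) → 𝕜) (i : Fin m → Fin N) :
    blockForm (p := p) hp2 hp hN n c (fun k => unitVec 𝕜 p (Nat.pair n (i k))) = c i := by
  simp only [blockForm, ContinuousMultilinearMap.compContinuousLinearMap_apply, coeffForm_apply,
    restrictCoords_apply]
  rw [Finset.sum_eq_single i]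
  · simp
  · intro j _ hj
    obtain ⟨k, hk⟩ := Function.ne_iff.1 hj
    refine mul_eq_zero_of_right _ (Finset.prod_eq_zero (Finset.mem_univ k) ?_)
    refine lp.single_apply_ne _ _ _ fun h => hk (Fin.ext (Nat.pair_eq_pair.1 h).2)
  · simp

lemma blockForm_unitVec_of_ne (hp2 : 2 ≤ p) (hp : p ≠ ∞) {m N : ℕ} (hN : 1 ≤ N) {n : ℕ}
    (c : (Fin m → Fin N) → 𝕜) {j : Fin m → ℕ} {k : Fin m} (hk : n ≠ (j k).unpair.1) :
    blockForm (p := p) hp2 hp hN n c (fun k => unitVec 𝕜 p (j k)) = 0 := by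
  simp only [blockForm, ContinuousMultilinearMap.compContinuousLinearMap_apply, coeffForm_apply,
    restrictCoords_apply]
  refine Finset.sum_eq_zero fun i _ => mul_eq_zero_of_right _
    (Finset.prod_eq_zero (Finset.mem_univ k) ?_)
  refine lp.single_apply_ne _ _ _ fun h => hk ?_
  rw [← h, Nat.unpair_pair]

end LpFact
end MultipleSumming

end

/-! ### Assembling the blocks -/

open MultipleSumming in
theorem theorem2p1 {𝕜 : Type*} [RCLike 𝕜] (m : ℕ) (hm : 1 ≤ m)
    (p : ℝ≥0∞) [Fact (1 ≤ p)] (hp2 : 2 ≤ p) (hp : p ≠ ∞)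
    (r s : ℝ) (hs1 : 1 ≤ s) (hsp : s < Real.conjExponent p.toReal)
    (hr0 : 0 < r) (hr : r < 2 * m * s / (s + 2 * m - m * s)) :
    MultipleSumming.IsMaximalSpaceable 𝕜
        {T : MultipleSumming.FormsOnLp 𝕜 m p | ¬ MultipleSumming.IsMultipleSumming r s T} ∧
      Module.rank 𝕜 (MultipleSumming.FormsOnLp 𝕜 m p) = 𝔠 := by
  have hP2 : 2 ≤ p.toReal := by simpa using ENNReal.toReal_mono hp hp2
  set P := p.toReal with hPdef
  have hs : 0 < s := by linarith
  have hm0 : (1 : ℝ) ≤ m := by exact_mod_cast hm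
  rw [Real.conjExponent, lt_div_iff₀ (by linarith)] at hsp
  have hs2 : s < 2 := by nlinarith
  set θ : ℝ := m / r - 1 / 2 + m / 2 - m / s with hθ
  have hθ0 : 0 < θ := by
    have hD : 0 < s + 2 * m - m * s := by nlinarith
    rw [lt_div_iff₀ hD] at hr
    have : θ = (2 * m * s - r * (s + 2 * m - m * s)) / (2 * r * s) := by
      rw [hθ]; field_simp; ring
    rw [this]
    exact div_pos (by linarith) (by positivity)
  -- The growth 4^n absorbs the weight 2^(-n) below and still leaves 2^n.
  have hN : ∀ n : ℕ, ∃ N : ℕ, 1 ≤ N ∧ (4 : ℝ) ^ n ≤ (N : ℝ) ^ θ := fun n =>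
    ((Filter.eventually_ge_atTop 1).and (((tendsto_rpow_atTop hθ0).comp
      tendsto_natCast_atTop_atTop).eventually_ge_atTop ((4 : ℝ) ^ n))).exists
  choose N hN1 hN4 using hN
  obtain ⟨K, hK, hform⟩ := exists_sign_form 𝕜 m
  choose ε hε hnorm using fun n => hform (N n) (hN1 n)
  have hNpos : ∀ n, (0 : ℝ) < N n := fun n => by exact_mod_cast hN1 n
  let D : ℕ → ℝ := fun n => Real.sqrt (N n) * ((N n : ℝ) ^ (1 / 2 - 1 / P)) ^ m
  have hD : ∀ n, 0 < D n := fun n => by have := hNpos n; positivity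
  let w : ℕ → ℝ := fun n => (1 / 2) ^ n / D n
  have hw : ∀ n, 0 < w n := fun n => div_pos (by positivity) (hD n)
  let F : ℕ → FormsOnLp 𝕜 m p := fun n => ((w n : ℝ) : 𝕜) • blockForm hp2 hp (hN1 n) n (ε n)
  have hF : ∀ n, ‖F n‖ ≤ K * (1 / 2) ^ n := fun n => by
    rw [norm_smul, RCLike.norm_ofReal, abs_of_pos (hw n)]
    calc w n * ‖blockForm (p := p) hp2 hp (hN1 n) n (ε n)‖ ≤ w n * (K * D n) := by
          refine mul_le_mul_of_nonneg_left ?_ (hw n).le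
          refine (norm_blockForm_le hp2 hp (hN1 n) n (ε n)).trans ?_
          rw [← mul_assoc]
          gcongr
          exact hnorm n
      _ = K * (1 / 2) ^ n := by
          simp only [w]
          have := (hD n).ne'
          field_simp
  let k₀ : Fin m := ⟨0, hm⟩
  -- One slot determines the block: if another slot lies in a different block, `F (ν j)` vanishes
  -- there and `t j = 0`.
  let ν : (Fin m → ℕ) → ℕ := fun j => (j k₀).unpair.1
  let t : (Fin m → ℕ) → 𝕜 := fun j => F (ν j) fun k => unitVec 𝕜 p (j k)
  have hFblock : ∀ n (i : Fin m → Fin (N n)),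
      F n (fun k => unitVec 𝕜 p (Nat.pair n (i k))) = ((w n : ℝ) : 𝕜) * ε n i := fun n i => by
    simp only [F, smul_apply, smul_eq_mul]
    rw [blockForm_unitVec]
  -- Unpairing the block number again gives its class: class `k` consists of the blocks `Nat.pair k
  -- l`, hence is infinite.
  refine isMaximalSpaceable_of_coefficients hp _ t (fun j => (ν j).unpair.1)
    (fun k _ => Nat.pair (Nat.pair k 0) 0) (fun k => by simp [ν]) (fun k => ?_) (fun c hc => ?_)
    (fun T k c hc hT hsum => ?_)
  · have := hFblock (Nat.pair k 0) fun _ => ⟨0, hN1 _⟩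
    simp only [t, ν, Nat.unpair_pair]
    refine this ▸ mul_ne_zero (by simpa using (hw _).ne') ?_
    rw [← norm_ne_zero_iff, hε]
    exact one_ne_zero
  · have hsummable : Summable fun n : ℕ => c n.unpair.1 • F n := by
      refine Summable.of_norm_bounded (g := fun n => K * (1 / 2) ^ n)
        ((summable_geometric_of_lt_one (by norm_num) (by norm_num)).mul_left K) fun n => ?_
      rw [norm_smul]
      exact (mul_le_of_le_one_left (norm_nonneg _) (hc _)).trans (hF n)
    refine ⟨∑' n, c n.unpair.1 • F n, fun j => ?_⟩
    have h1 := (ContinuousMultilinearMap.apply 𝕜 (fun _ : Fin m => lp (fun _ : ℕ => 𝕜) p) 𝕜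
      (fun k => unitVec 𝕜 p (j k))).map_tsum hsummable
    simp only [ContinuousMultilinearMap.apply_apply] at h1
    rw [h1, tsum_eq_single (ν j)]
    · simp [t]
    · intro n hn
      simp only [F, smul_apply]
      rw [blockForm_unitVec_of_ne hp2 hp (hN1 n) (ε n) (k := k₀) hn]
      simp
  · obtain ⟨C, -, hC⟩ := hsum
    have hbound : ∀ l : ℕ, ‖c‖ * 2 ^ Nat.pair k l ≤ C := by
      intro l
      set n := Nat.pair k l with hn
      have hNn := hNpos n
      have hest := summing_block_estimate hp hr0 hs1 (by linarith) hC (hN1 n)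
        (pair_val_injective n (N n))
        (a := ‖c‖ * w n) (mul_nonneg (norm_nonneg _) (hw n).le) (fun i => by
          rw [hT _ (by simp [ν, hn])]
          simp only [t, ν, Nat.unpair_pair]
          rw [hFblock, norm_mul, norm_mul, hε, RCLike.norm_ofReal, abs_of_pos (hw n), mul_one])
      -- The exponent count that defines θ: it is the excess of m/r over the exponents of the weak
      -- norms and of `D n`.
      have hexp : ((N n : ℝ) ^ (1 / s + 1 / P - 1)) ^ m * D n * (N n : ℝ) ^ θ =
          (N n : ℝ) ^ (m / r) := by
        simp only [D]
        rw [Real.sqrt_eq_rpow, ← Real.rpow_natCast ((N n : ℝ) ^ _),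
          ← Real.rpow_natCast ((N n : ℝ) ^ _), ← Real.rpow_mul hNn.le, ← Real.rpow_mul hNn.le,
          ← Real.rpow_add hNn, ← Real.rpow_add hNn, ← Real.rpow_add hNn, hθ]
        congr 1
        field_simp
        ring
      have hY : 0 < ((N n : ℝ) ^ (1 / s + 1 / P - 1)) ^ m := by positivity
      have h2 : ((N n : ℝ) ^ (1 / s + 1 / P - 1)) ^ m * ((N n : ℝ) ^ θ * ‖c‖ * (1 / 2) ^ n) ≤
          ((N n : ℝ) ^ (1 / s + 1 / P - 1)) ^ m * C := by
        refine le_trans (le_of_eq ?_) (hest.trans_eq (mul_comm _ _))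
        rw [← hexp]
        simp only [w]
        have := (hD n).ne'
        field_simp
      refine le_trans ?_ (le_of_mul_le_mul_left h2 hY)
      calc ‖c‖ * 2 ^ n = 4 ^ n * ‖c‖ * (1 / 2) ^ n := by
            rw [mul_right_comm, ← mul_pow]; norm_num [mul_comm]
        _ ≤ _ := by gcongr; exact hN4 n
    have hc0 : 0 < ‖c‖ := norm_pos_iff.2 hc
    obtain ⟨l, hl⟩ := pow_unbounded_of_one_lt (C / ‖c‖ : ℝ) (one_lt_two)
    rw [div_lt_iff₀ hc0] at hl
    have h3 : (2 : ℝ) ^ l ≤ 2 ^ Nat.pair k l :=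
      pow_le_pow_right₀ one_le_two (Nat.right_le_pair k l)
    have := hbound l
    nlinarith
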